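/- Let $n\ge 1$ be an integer and let $\mathbb F$ be a field. A linear representation of the cyclic quiver $\mathcal C_n$ is a family $u=(U_k,u_k)_{k\in\mathbb Z/n}$ of $\mathbb F$-vector spaces $U_k$ and linear maps $u_k:U_k\to U_{k+1}$. Its dimension is $\sum_{k}\dim U_k$. It is called locally nilpotent if for every $x\in U_0$ some power of the endomorphism $u_{n-1}\circ\cdots\circ u_1\circ u_0$ of $U_0$ annihilates $x$. Two representations $(U_k,u_k)_k$ and $(V_k,v_k)_k$ are isomorphic if there are linear isomorphisms $\varphi_k:U_k\to V_k$ with $v_k\circ\varphi_k=\varphi_{k+1}\circ u_k$ for all $k\in\mathbb Z/n$. For a linear representation $u=(U_k,u_k)_{k}$, define subspaces $U_{k,\alpha}\subseteq U_k$, for all $k\in\mathbb Z/n$ and all ordinals $\alpha$, by $U_{k,0}=U_k$, $U_{k,\alpha+1}=u_{k-1}(U_{k-1,\alpha})$, and $U_{k,\alpha}=\bigcap_{\beta<\alpha}U_{k,\beta}$ if $\alpha$ is a limit ordinal; these chains are non-increasing in $\alpha$. Put $U_{k,\infty}=\bigcap_{\alpha}U_{k,\alpha}$, the intersection being over all ordinals.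 The cyclic Kaplansky invariants of $u$ are the cardinals $$\kappa_{k,\infty}(u)=\dim\bigl(U_{k,\infty}\cap\operatorname{Ker}u_k\bigr)$$ and, for every ordinal $\alpha$, $$\kappa_{k,\alpha}(u)=\dim\operatorname{Ker}\bigl(U_{k,\alpha}/U_{k,\alpha+1}\to U_{k+1,\alpha+1}/U_{k+1,\alpha+2}\bigr),$$ where the map is the one induced by $u_k$. Theorem. Let $u$ and $v$ be locally nilpotent linear representations of $\mathcal C_n$ over $\mathbb F$ of (finite or infinite) countable dimension. Then $u$ and $v$ are isomorphic if and only if $\kappa_{k,\alpha}(u)=\kappa_{k,\alpha}(v)$ for all $k\in\mathbb Z/n$ and all $\alpha\in\omega_1\cup\{\infty\}$, where $\omega_1$ is the first uncountable ordinal, i.e. the set of all countable ordinals. -/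

import Mathlib

universe u w

/-- A linear representation over the field `F` of the cyclic quiver `C_n`, whose vertices are the
elements of `ZMod n` and which has exactly one arrow from `k` to `l` if `l = k + 1`, and no arrow
from `k` to `l` otherwise. So this is a family of vector spaces `U k` together with one linear map
`u_k : U k → U (k + 1)` for every `k`. The target vertex `l` of `u_k` is a separate argument, with a
proof of `k + 1 = l`, so that equal but not syntactically equal indices need no casts. -/
structure CyclicRep (F : Type u) [Field F] (n : ℕ) where
  /-- the vector space at each vertex -/
  space : ZMod n → Type w
  [addCommGroup : ∀ k, AddCommGroup (space k)]
  [module : ∀ k, Module F (space k)]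
  /-- the linear map on the arrow from `k` to `k + 1` -/
  map : ∀ k l : ZMod n, k + 1 = l → (space k →ₗ[F] space l)

namespace CyclicRep

attribute [instance] CyclicRep.addCommGroup CyclicRep.module

variable {F : Type u} [Field F] {n : ℕ}

/-- The dimension of a representation: the sum of the dimensions of its spaces, as a cardinal. -/
noncomputable def dim (U : CyclicRep.{u, w} F n) : Cardinal.{w} :=
  Cardinal.sum fun k : ZMod n => Module.rank F (U.space k)

/-- Two representations are isomorphic when there is a family of linear isomorphisms
`φ k : U k ≃ V k` that commutes with the maps of the representations. -/
def IsIsomorphic (U V : CyclicRep.{u, w} F n) : Prop :=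
  ∃ φ : ∀ k : ZMod n, U.space k ≃ₗ[F] V.space k,
    ∀ (k l : ZMod n) (h : k + 1 = l), V.map k l h ∘ₗ (φ k : U.space k →ₗ[F] V.space k) =
      (φ l : U.space l →ₗ[F] V.space l) ∘ₗ U.map k l h

/-- The composite `u_{k+i-1} ∘ ⋯ ∘ u_{k+1} ∘ u_k` of `i` successive maps, from the space at `k` to
the space at `l = k + i`. -/
def comp (U : CyclicRep.{u, w} F n) (k : ZMod n) :
    ∀ (i : ℕ) (l : ZMod n), k + (i : ZMod n) = l → (U.space k →ₗ[F] U.space l)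
  | 0, l, h => by
      have hkl : k = l := by simpa using h
      exact hkl ▸ LinearMap.id
  | i + 1, l, h =>
      U.map (k + (i : ZMod n)) l (by rw [← h]; push_cast; ring) ∘ₗ U.comp k i (k + (i : ZMod n)) rfl

/-- The endomorphism `(π u)_k = u_{k+n-1} ∘ ⋯ ∘ u_{k+1} ∘ u_k` of the space at `k`. -/
def cycle (U : CyclicRep.{u, w} F n) (k : ZMod n) : Module.End F (U.space k) :=
  U.comp k n k (by simp)

/-- A representation is locally nilpotent when the endomorphism `(π u)_0` is: every vector of the
space at `0` is annihilated by some power of it. -/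
def IsLocallyNilpotent (U : CyclicRep.{u, w} F n) : Prop :=
  ∀ x : U.space 0, ∃ m : ℕ, (U.cycle 0 ^ m) x = 0

/-- The family of images of a family of subspaces: at `k` it is `u_{k-1} (W_{k-1})`. -/
def image (U : CyclicRep.{u, w} F n) (W : ∀ k, Submodule F (U.space k)) (k : ZMod n) :
    Submodule F (U.space k) :=
  (W (k - 1)).map (U.map (k - 1) k (sub_add_cancel k 1))

/-- The transfinite chain of subspaces `U_{k,α}`: `U_{k,0} = U_k`,
`U_{k,α+1} = u_{k-1} (U_{k-1,α})`, and `U_{k,α} = ⋂_{β < α} U_{k,β}` for limit `α`. -/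
noncomputable def chain (U : CyclicRep.{u, w} F n) (α : Ordinal.{w}) :
    ∀ k, Submodule F (U.space k) :=
  Ordinal.limitRecOn (motive := fun _ => ∀ k, Submodule F (U.space k)) α
    (fun _ => ⊤)
    (fun _ W => U.image W)
    (fun α _ W k => ⨅ (β : Ordinal.{w}) (hβ : β < α), W β hβ k)

/-- The subspace `U_{k,∞}`, the intersection of all the `U_{k,α}`. -/
noncomputable def chainInf (U : CyclicRep.{u, w} F n) (k : ZMod n) : Submodule F (U.space k) :=
  ⨅ α : Ordinal.{w}, U.chain α k

theorem chain_zero (U : CyclicRep.{u, w} F n) (k : ZMod n) : U.chain 0 k = ⊤ := by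
  simp [chain]

theorem chain_add_one (U : CyclicRep.{u, w} F n) (α : Ordinal.{w}) (k : ZMod n) :
    U.chain (α + 1) k = (U.chain α (k - 1)).map (U.map (k - 1) k (sub_add_cancel k 1)) := by
  simp only [chain, Ordinal.limitRecOn_add_one, image]

theorem chain_limit (U : CyclicRep.{u, w} F n) (α : Ordinal.{w}) (hα : Order.IsSuccLimit α)
    (k : ZMod n) : U.chain α k = ⨅ (β : Ordinal.{w}) (_ : β < α), U.chain β k := by
  simp only [chain]
  rw [Ordinal.limitRecOn_limit _ _ _ _ hα]

theorem chain_map (U : CyclicRep.{u, w} F n) (α : Ordinal.{w}) (k l : ZMod n) (h : k + 1 = l) :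
    (U.chain α k).map (U.map k l h) = U.chain (α + 1) l := by
  obtain rfl : k = l - 1 := by rw [← h]; ring
  rw [chain_add_one]

theorem map_mem_chain (U : CyclicRep.{u, w} F n) (α : Ordinal.{w}) (k l : ZMod n) (h : k + 1 = l)
    {x : U.space k} (hx : x ∈ U.chain α k) : U.map k l h x ∈ U.chain (α + 1) l := by
  rw [← U.chain_map α k l h]
  exact Submodule.mem_map_of_mem hx

/-- The quotient `U_{k,α} / U_{k,α+1}`. -/
abbrev layer (U : CyclicRep.{u, w} F n) (k : ZMod n) (α : Ordinal.{w}) : Type w :=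
  U.chain α k ⧸ (U.chain (α + 1) k).submoduleOf (U.chain α k)

/-- The restriction `U_{k,α} → U_{k+1,α+1}` of `u_k`. -/
noncomputable def restrictMap (U : CyclicRep.{u, w} F n) (k : ZMod n) (α : Ordinal.{w}) :
    U.chain α k →ₗ[F] U.chain (α + 1) (k + 1) :=
  (U.map k (k + 1) rfl).restrict fun _ hx => U.map_mem_chain α k (k + 1) rfl hx

/-- The map `u_{k,α} : U_{k,α} / U_{k,α+1} → U_{k+1,α+1} / U_{k+1,α+2}` induced by `u_k`. -/
noncomputable def layerMap (U : CyclicRep.{u, w} F n) (k : ZMod n) (α : Ordinal.{w}) :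
    U.layer k α →ₗ[F] U.layer (k + 1) (α + 1) :=
  Submodule.mapQ _ _ (U.restrictMap k α) fun _ hx =>
    U.map_mem_chain (α + 1) k (k + 1) rfl hx

/-- The `(k,α)`-th Kaplansky invariant `κ_{k,α}`, for an ordinal `α`. -/
noncomputable def kaplansky (U : CyclicRep.{u, w} F n) (k : ZMod n) (α : Ordinal.{w}) :
    Cardinal.{w} :=
  Module.rank F (LinearMap.ker (U.layerMap k α))

/-- The `(k,∞)`-th Kaplansky invariant `κ_{k,∞} = dim (U_{k,∞} ∩ Ker u_k)`. -/
noncomputable def kaplanskyInf (U : CyclicRep.{u, w} F n) (k : ZMod n) : Cardinal.{w} :=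
  Module.rank F ↥(U.chainInf k ⊓ LinearMap.ker (U.map k (k + 1) rfl))

end CyclicRep

/-!
The theorem is proved by the back-and-forth method of Kaplansky and Mackey for Ulm's theorem.

The invariants are computed from the chains `U_{k,α}`, which isomorphisms preserve, so one
direction is formal. Conversely, consider the finite partial isomorphisms: finite-dimensional
families of linear relations between the spaces of `U` and `V`, stable under the maps, one-to-one,
and matching `U_{k,α}` with `V_{k,α}` for all `α` (`CyclicRep.FinPartialIso`). Each of them can be
extended so that its domain contains a given vector `x`. By local nilpotency
(`CyclicRep.IsLocallyNilpotent.induction`) `u_k x` may be assumed to lie in the domain already, and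
as the domain `S` is finite-dimensional, `x` may be replaced by a vector of `S + F x` outside `S`
whose position in the chain is as deep as possible (`CyclicRep.exists_last_escape`). Let `z` be the
vector matched with `u_k x`.

* If `x` lies in `U_{k,∞}`, it is matched with a preimage of `z` in `V_{k,∞}`. Such a preimage can
  be taken outside the range because `κ_{k,∞}` is the same on both sides
  (`FinPartialIso.exists_mem_dom_of_chainInf`).
* If `x` lies in `U_{k,γ}`, with all its translates by `S` outside `U_{k,γ+1}`, and `u_k` sends no
  translate of `x` in `U_{k,γ}` into `U_{k+1,γ+2}`, then any preimage of `z` in `V_{k,γ}` will do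
  (`FinPartialIso.exists_mem_dom_of_proper`).
* Otherwise, after a translation, `u_k x` lies in `U_{k+1,γ+2}`, and `x` has a class in the kernel
  defining `κ_{k,γ}` that does not come from `S`. The classes coming from `S` and from the range
  form finite-dimensional subspaces of equal dimension, and the equality of `κ_{k,γ}` on both sides
  gives a suitable vector of `V` (`FinPartialIso.exists_mem_dom_of_jump`).

Only countable `γ` occur, because in countable dimension the chains stabilise before `ω₁`
(`CyclicRep.exists_chain_add_one_eq`). As the dimensions are countable, an ideal of partial
isomorphisms meeting countably many cofinal sets covers bases on both sides, and its union is the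
graph of an isomorphism (`CyclicRep.isIsomorphic_of_ideal`).
-/

namespace CyclicRep

variable {F : Type u} [Field F] {n : ℕ}

/-! ### The chain of iterated images -/

theorem chain_antitone (U : CyclicRep.{u, w} F n) (k : ZMod n) :
    Antitone fun α : Ordinal.{w} => U.chain α k := by
  suffices H : ∀ α : Ordinal.{w}, ∀ (k : ZMod n) (β : Ordinal.{w}), β ≤ α →
      U.chain α k ≤ U.chain β k from fun β α h => H α k β h
  intro α
  induction α using WellFoundedLT.induction with
  | ind α ih =>
    intro k β hβ
    rcases hβ.eq_or_lt with rfl | hβ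
    · exact le_rfl
    rcases Ordinal.zero_or_succ_or_isSuccLimit α with rfl | ⟨γ, rfl⟩ | hα
    · exact absurd hβ not_lt_zero
    · rw [Order.succ_eq_add_one] at hβ ih ⊢
      have hγ : γ < γ + 1 := Order.lt_add_one_iff.2 le_rfl
      refine le_trans ?_ (ih γ hγ k β (Order.lt_add_one_iff.1 hβ))
      -- It remains to compare `γ + 1` with `γ`.
      rcases Ordinal.zero_or_succ_or_isSuccLimit γ with rfl | ⟨δ, rfl⟩ | hγl
      · rw [chain_zero]
        exact le_top
      · rw [Order.succ_eq_add_one] at hγ ih ⊢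
        rw [U.chain_add_one _ k, U.chain_add_one δ k]
        exact Submodule.map_mono (ih _ hγ _ _ (Order.lt_add_one_iff.2 le_rfl).le)
      · conv_rhs => rw [chain_limit _ _ hγl]
        refine le_iInf₂ fun δ hδ => ?_
        have h1 : U.chain (γ + 1) k ≤ U.chain (δ + 1) k := by
          rw [U.chain_add_one _ k, U.chain_add_one δ k]
          exact Submodule.map_mono (ih γ hγ _ _ hδ.le)
        have h2 : δ + 1 < γ := by simpa using hγl.succ_lt hδ
        exact h1.trans (ih _ (h2.trans hγ) k δ (Order.lt_add_one_iff.2 le_rfl).le)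
    · rw [chain_limit _ _ hα]
      exact iInf₂_le β hβ

theorem exists_chain_preimage (U : CyclicRep.{u, w} F n) (α : Ordinal.{w}) (k l : ZMod n)
    (h : k + 1 = l) {y : U.space l} (hy : y ∈ U.chain (α + 1) l) :
    ∃ x ∈ U.chain α k, U.map k l h x = y := by
  rwa [← U.chain_map α k l h, Submodule.mem_map] at hy

theorem mem_chainInf {U : CyclicRep.{u, w} F n} {k : ZMod n} {x : U.space k} :
    x ∈ U.chainInf k ↔ ∀ α : Ordinal.{w}, x ∈ U.chain α k := by
  simp [chainInf]

/-- A family of vectors leaving a decreasing chain of subspaces at distinct indices is linearly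
independent. -/
theorem linearIndependent_of_antitone {ι M : Type*} [LinearOrder ι] [AddCommGroup M] [Module F M]
    {W W' : ι → Submodule F M} (hW : ∀ i j, i < j → W j ≤ W' i) {x : ι → M}
    (hx : ∀ i, x i ∈ W i) (hx' : ∀ i, x i ∉ W' i) : LinearIndependent F x := by
  classical
  rw [linearIndependent_iff']
  intro s g hg
  by_contra! hne
  have hs : (s.filter fun i => g i ≠ 0).Nonempty := by
    obtain ⟨i, hi, hgi⟩ := hne
    exact ⟨i, Finset.mem_filter.2 ⟨hi, hgi⟩⟩
  -- the smallest index with a nonzero coefficient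
  set i := (s.filter fun i => g i ≠ 0).min' hs with hi
  obtain ⟨his, hgi⟩ := Finset.mem_filter.1 ((s.filter fun i => g i ≠ 0).min'_mem hs)
  rw [← hi] at his hgi
  rw [← Finset.add_sum_erase s _ his] at hg
  refine hx' i ?_
  have hsum : ∑ j ∈ s.erase i, g j • x j ∈ W' i := by
    refine Submodule.sum_mem _ fun j hj => ?_
    obtain ⟨hji, hjs⟩ := Finset.mem_erase.1 hj
    by_cases hgj : g j = 0
    · simp [hgj]
    · have hij : i ≤ j := Finset.min'_le _ _ (Finset.mem_filter.2 ⟨hjs, hgj⟩)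
      exact Submodule.smul_mem _ _ (hW i j (lt_of_le_of_ne hij hji.symm) (hx j))
  rw [← (W' i).smul_mem_iff hgi, eq_neg_of_add_eq_zero_left hg]
  exact neg_mem hsum

theorem not_countable_Iio_omega_one : ¬ (Set.Iio (Ordinal.omega.{w} 1)).Countable := by
  intro h
  have h := h.le_aleph0
  rw [Cardinal.mk_Iio_ordinal, Cardinal.lift_le_aleph0] at h
  simp at h

theorem rank_le_aleph0 {U : CyclicRep.{u, w} F n} (hU : U.dim ≤ Cardinal.aleph0) (k : ZMod n) :
    Module.rank F (U.space k) ≤ Cardinal.aleph0 :=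
  (Cardinal.le_sum.{0, w} _ k).trans hU

/-- In countable dimension the chain stabilises at a countable ordinal, since otherwise some
`U_k` would contain an uncountable linearly independent family. -/
theorem exists_chain_add_one_eq [NeZero n] {U : CyclicRep.{u, w} F n}
    (hU : U.dim ≤ Cardinal.aleph0) :
    ∃ o : Ordinal.{w}, o < Ordinal.omega 1 ∧ ∀ k, U.chain (o + 1) k = U.chain o k := by
  by_contra! H
  let A : ZMod n → Set Ordinal.{w} := fun k => {α | U.chain (α + 1) k ≠ U.chain α k}
  refine not_countable_Iio_omega_one ((Set.countable_iUnion (t := A) fun k => ?_).mono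
    fun α hα => Set.mem_iUnion.2 (H α hα))
  have hA : ∀ α : A k, ∃ x, x ∈ U.chain α k ∧ x ∉ U.chain (α.1 + 1) k := by
    rintro ⟨α, hα⟩
    by_contra! h
    exact hα (le_antisymm (U.chain_antitone k (Order.le_succ α)) h)
  choose x hx hx' using hA
  have hli : LinearIndependent F x :=
    linearIndependent_of_antitone (W := fun α : A k => U.chain α k)
      (W' := fun α : A k => U.chain (α.1 + 1) k)
      (fun i j hij => U.chain_antitone k (Order.add_one_le_of_lt hij)) hx hx'
  have h := hli.cardinal_lift_le_rank
  rw [← Cardinal.le_aleph0_iff_set_countable, ← Cardinal.lift_le_aleph0.{w + 1, w}]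
  exact h.trans (Cardinal.lift_le_aleph0.2 (rank_le_aleph0 hU k))

theorem chain_eq_of_le {U : CyclicRep.{u, w} F n} {o : Ordinal.{w}}
    (ho : ∀ k, U.chain (o + 1) k = U.chain o k) {α : Ordinal.{w}} (hα : o ≤ α) (k : ZMod n) :
    U.chain α k = U.chain o k := by
  induction α using Ordinal.limitRecOn generalizing k with
  | zero => rw [le_antisymm hα (zero_le)]
  | add_one α ih =>
    rcases hα.eq_or_lt with rfl | hα
    · rfl
    · rw [chain_add_one, ih (Order.lt_add_one_iff.1 hα), ← chain_add_one, ho]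
  | limit α hl ih =>
    refine le_antisymm (U.chain_antitone k hα) ?_
    rw [chain_limit _ _ hl]
    refine le_iInf₂ fun β hβ => ?_
    rcases le_total o β with h | h
    · exact (ih β hβ h k).ge
    · exact U.chain_antitone k h

theorem chainInf_eq {U : CyclicRep.{u, w} F n} {o : Ordinal.{w}}
    (ho : ∀ k, U.chain (o + 1) k = U.chain o k) (k : ZMod n) :
    U.chainInf k = U.chain o k := by
  refine le_antisymm (iInf_le _ o) (le_iInf fun α => ?_)
  rcases le_total o α with h | h
  · exact (chain_eq_of_le ho h k).ge
  · exact U.chain_antitone k h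

theorem exists_chainInf_preimage {U : CyclicRep.{u, w} F n} {o : Ordinal.{w}}
    (ho : ∀ k, U.chain (o + 1) k = U.chain o k) (k l : ZMod n) (h : k + 1 = l) {y : U.space l}
    (hy : y ∈ U.chainInf l) : ∃ x ∈ U.chainInf k, U.map k l h x = y := by
  rw [chainInf_eq ho, ← ho] at hy
  rw [chainInf_eq ho]
  exact U.exists_chain_preimage o k l h hy

theorem lt_of_mem_chain_of_notMem {U : CyclicRep.{u, w} F n} {o : Ordinal.{w}}
    (ho : ∀ k, U.chain (o + 1) k = U.chain o k) {α : Ordinal.{w}} {k : ZMod n} {x : U.space k}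
    (hx : x ∈ U.chain α k) (hx' : x ∉ U.chain (α + 1) k) : α < o := by
  by_contra! h
  rw [chain_eq_of_le ho h] at hx
  rw [chain_eq_of_le ho (h.trans (le_add_right le_rfl))] at hx'
  exact hx' hx

/-! ### Kaplansky invariants as dimensions of quotients -/

/-- The vectors of `U_{k,α}` that `u_k` maps into `U_{k+1,α+2}`; its quotient by `U_{k,α+1}` is
the kernel whose dimension is the invariant `κ_{k,α}`. -/
noncomputable def jump (U : CyclicRep.{u, w} F n) (k : ZMod n) (α : Ordinal.{w}) :
    Submodule F (U.space k) :=
  U.chain α k ⊓ (U.chain (α + 1 + 1) (k + 1)).comap (U.map k (k + 1) rfl)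

/-- The projection of `U.jump k α` onto the kernel of `U.layerMap k α`. -/
noncomputable def jumpToKer (U : CyclicRep.{u, w} F n) (k : ZMod n) (α : Ordinal.{w}) :
    U.jump k α →ₗ[F] LinearMap.ker (U.layerMap k α) :=
  (Submodule.mkQ _ ∘ₗ Submodule.inclusion (inf_le_left : U.jump k α ≤ U.chain α k)).codRestrict _
    fun x => (Submodule.Quotient.mk_eq_zero _).2 x.2.2

theorem jumpToKer_surjective (U : CyclicRep.{u, w} F n) (k : ZMod n) (α : Ordinal.{w}) :
    Function.Surjective (U.jumpToKer k α) := by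
  rintro ⟨q, hq⟩
  obtain ⟨x, rfl⟩ := Submodule.mkQ_surjective _ q
  have hx : U.restrictMap k α x ∈
      (U.chain (α + 1 + 1) (k + 1)).submoduleOf (U.chain (α + 1) (k + 1)) :=
    (Submodule.Quotient.mk_eq_zero _).1 hq
  exact ⟨⟨x.1, x.2, hx⟩, rfl⟩

theorem jumpToKer_eq_zero_iff {U : CyclicRep.{u, w} F n} {k : ZMod n} {α : Ordinal.{w}}
    {x : U.jump k α} : U.jumpToKer k α x = 0 ↔ (x : U.space k) ∈ U.chain (α + 1) k := by
  rw [← Subtype.coe_inj]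
  exact Submodule.Quotient.mk_eq_zero _

theorem rank_eq_of_surjective_of_ker_eq {H A B : Type w} [AddCommGroup H] [Module F H]
    [AddCommGroup A] [Module F A] [AddCommGroup B] [Module F B] (f : H →ₗ[F] A) (g : H →ₗ[F] B)
    (hf : Function.Surjective f) (hg : Function.Surjective g) (h : ∀ x, f x = 0 ↔ g x = 0) :
    Module.rank F A = Module.rank F B := by
  have hk : LinearMap.ker f = LinearMap.ker g := Submodule.ext h
  exact ((f.quotKerEquivOfSurjective hf).symm.trans ((Submodule.quotEquivOfEq _ _ hk).trans
    (g.quotKerEquivOfSurjective hg))).rank_eq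

/-- Two linear maps with the same kernel on a finite-dimensional space, into spaces of equal
dimension: if one is surjective, so is the other. -/
theorem surjective_of_ker_eq {H A B : Type w} [AddCommGroup H] [Module F H]
    [FiniteDimensional F H] [AddCommGroup A] [Module F A] [AddCommGroup B] [Module F B]
    (f : H →ₗ[F] A) (g : H →ₗ[F] B) (h : ∀ x, f x = 0 ↔ g x = 0)
    (hAB : Module.rank F A = Module.rank F B) (hg : Function.Surjective g) :
    Function.Surjective f := by
  have hB : FiniteDimensional F B := Module.Finite.of_surjective g hg
  have hA : FiniteDimensional F A := by
    rw [FiniteDimensional, ← Module.rank_lt_aleph0_iff, hAB, Module.rank_lt_aleph0_iff]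
    exact hB
  have hr : Module.rank F (LinearMap.range f) = Module.rank F B :=
    rank_eq_of_surjective_of_ker_eq f.rangeRestrict g f.surjective_rangeRestrict hg fun x => by
      rw [← h x, ← Subtype.coe_inj]
      rfl
  rw [← LinearMap.range_eq_top]
  refine Submodule.eq_top_of_finrank_eq ?_
  rw [Module.finrank, Module.finrank, hr, hAB]

/-! ### Invariance under isomorphism -/

theorem mem_chain_iff_of_iso {U V : CyclicRep.{u, w} F n}
    (φ : ∀ k : ZMod n, U.space k ≃ₗ[F] V.space k)
    (hφ : ∀ (k l : ZMod n) (h : k + 1 = l) (x : U.space k),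
      V.map k l h (φ k x) = φ l (U.map k l h x))
    (α : Ordinal.{w}) (k : ZMod n) (x : U.space k) :
    φ k x ∈ V.chain α k ↔ x ∈ U.chain α k := by
  induction α using Ordinal.limitRecOn generalizing k with
  | zero => simp [chain_zero]
  | add_one α ih =>
    rw [chain_add_one, chain_add_one, Submodule.mem_map, Submodule.mem_map]
    constructor
    · rintro ⟨y, hy, hyx⟩
      refine ⟨(φ _).symm y, ?_, ?_⟩
      · rwa [← ih, LinearEquiv.apply_symm_apply]
      · apply (φ k).injective
        rw [← hφ, LinearEquiv.apply_symm_apply, hyx]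
    · rintro ⟨y, hy, rfl⟩
      exact ⟨φ _ y, (ih _ y).2 hy, hφ _ _ _ y⟩
  | limit α hl ih =>
    simp only [chain_limit _ _ hl, Submodule.mem_iInf]
    exact forall₂_congr fun β hβ => ih β hβ k x

theorem kaplansky_eq_of_iso {U V : CyclicRep.{u, w} F n}
    (φ : ∀ k : ZMod n, U.space k ≃ₗ[F] V.space k)
    (hφ : ∀ (k l : ZMod n) (h : k + 1 = l) (x : U.space k),
      V.map k l h (φ k x) = φ l (U.map k l h x))
    (k : ZMod n) (α : Ordinal.{w}) : U.kaplansky k α = V.kaplansky k α := by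
  have hmem : ∀ x, φ k x ∈ V.jump k α ↔ x ∈ U.jump k α := fun x => by
    simp only [jump, Submodule.mem_inf, Submodule.mem_comap, hφ, mem_chain_iff_of_iso φ hφ]
  refine rank_eq_of_surjective_of_ker_eq (U.jumpToKer k α)
    (V.jumpToKer k α ∘ₗ (φ k).toLinearMap.restrict fun x hx => (hmem x).2 hx)
    (U.jumpToKer_surjective k α) ?_ fun x => ?_
  · rw [LinearMap.coe_comp]
    refine (V.jumpToKer_surjective k α).comp fun y => ?_
    obtain ⟨x, hx⟩ := (φ k).surjective y
    exact ⟨⟨x, (hmem x).1 (hx ▸ y.2)⟩, Subtype.ext hx⟩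
  · rw [LinearMap.comp_apply, jumpToKer_eq_zero_iff, jumpToKer_eq_zero_iff]
    exact (mem_chain_iff_of_iso φ hφ _ _ _).symm

theorem kaplanskyInf_eq_of_iso {U V : CyclicRep.{u, w} F n}
    (φ : ∀ k : ZMod n, U.space k ≃ₗ[F] V.space k)
    (hφ : ∀ (k l : ZMod n) (h : k + 1 = l) (x : U.space k),
      V.map k l h (φ k x) = φ l (U.map k l h x))
    (k : ZMod n) : U.kaplanskyInf k = V.kaplanskyInf k := by
  refine ((φ k).submoduleMap _).rank_eq.trans (LinearEquiv.ofEq _ _ ?_).rank_eq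
  ext y
  obtain ⟨x, rfl⟩ := (φ k).surjective y
  simp [mem_chainInf, mem_chain_iff_of_iso φ hφ, hφ]

/-! ### Induction along the arrows -/

theorem induction_comp {U : CyclicRep.{u, w} F n} {P : ∀ k : ZMod n, U.space k → Prop}
    (map : ∀ (k l : ZMod n) (h : k + 1 = l) (x : U.space k), P l (U.map k l h x) → P k x)
    (k : ZMod n) (x : U.space k) (i : ℕ) (l : ZMod n) (h : k + (i : ZMod n) = l)
    (hP : P l (U.comp k i l h x)) : P k x := by
  induction i generalizing l with
  | zero =>
    obtain rfl : k = l := by simpa using h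
    exact hP
  | succ i ih => exact ih _ rfl (map _ _ _ _ hP)

/-- In a locally nilpotent representation, a property that holds for zero vectors and passes from
`u_k x` to `x` holds for every vector. -/
theorem IsLocallyNilpotent.induction [NeZero n] {U : CyclicRep.{u, w} F n}
    (hU : U.IsLocallyNilpotent) {P : ∀ k : ZMod n, U.space k → Prop} (zero : ∀ k, P k 0)
    (map : ∀ (k l : ZMod n) (h : k + 1 = l) (x : U.space k), P l (U.map k l h x) → P k x)
    (k : ZMod n) (x : U.space k) : P k x := by
  have h0 : ∀ x : U.space 0, P 0 x := by
    intro x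
    obtain ⟨m, hm⟩ := hU x
    have key : ∀ m : ℕ, P 0 ((U.cycle 0 ^ m) x) → P 0 x := by
      intro m
      induction m with
      | zero => exact id
      | succ m ih =>
        rw [pow_succ', Module.End.mul_apply]
        exact fun h => ih (induction_comp map 0 _ n 0 _ h)
    exact key m (hm ▸ zero 0)
  exact induction_comp map k x (-k).val 0 (by simp) (h0 _)

/-! ### Finite partial isomorphisms -/

/-- A finite partial isomorphism between two representations, encoded by its graph: a family of
finite-dimensional subspaces `graph k` of `U_k × V_k`, stable under the maps, which is one-to-one
and matches each `U_{k,α}` with `V_{k,α}`. -/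
structure FinPartialIso (U V : CyclicRep.{u, w} F n) where
  /-- the graph at each vertex -/
  graph : ∀ k : ZMod n, Submodule F (U.space k × V.space k)
  finite : ∀ k, FiniteDimensional F (graph k)
  map_mem : ∀ (k l : ZMod n) (h : k + 1 = l) (p : U.space k × V.space k), p ∈ graph k →
    (U.map k l h p.1, V.map k l h p.2) ∈ graph l
  chain_iff : ∀ (k : ZMod n) (p : U.space k × V.space k), p ∈ graph k → ∀ α : Ordinal.{w},
    p.1 ∈ U.chain α k ↔ p.2 ∈ V.chain α k
  zero_iff : ∀ (k : ZMod n) (p : U.space k × V.space k), p ∈ graph k → (p.1 = 0 ↔ p.2 = 0)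

namespace FinPartialIso

variable {U V : CyclicRep.{u, w} F n}

instance : Preorder (FinPartialIso U V) := Preorder.lift graph

theorem le_def {G H : FinPartialIso U V} : G ≤ H ↔ ∀ k, G.graph k ≤ H.graph k := Iff.rfl

/-- The finite partial isomorphism between the zero subspaces. -/
instance : Inhabited (FinPartialIso U V) where
  default :=
    { graph := fun _ => ⊥
      finite := fun _ => inferInstance
      map_mem := by
        rintro k l h p hp
        rw [Submodule.mem_bot] at hp
        simp [hp]
      chain_iff := by
        rintro k p hp α
        rw [Submodule.mem_bot] at hp
        simp [hp]
      zero_iff := by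
        rintro k p hp
        rw [Submodule.mem_bot] at hp
        simp [hp] }

/-- The inverse of a finite partial isomorphism. -/
def symm (G : FinPartialIso U V) : FinPartialIso V U where
  graph k := (G.graph k).comap (LinearEquiv.prodComm F (V.space k) (U.space k)).toLinearMap
  finite k :=
    have := G.finite k
    LinearEquiv.finiteDimensional
      ((LinearEquiv.prodComm F (V.space k) (U.space k)).symm.submoduleMap (G.graph k) |>.trans
        (LinearEquiv.ofEq _ _ (Submodule.map_equiv_eq_comap_symm _ _)))
  map_mem k l h p hp := G.map_mem k l h (p.2, p.1) hp
  chain_iff k p hp α := (G.chain_iff k (p.2, p.1) hp α).symm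
  zero_iff k p hp := (G.zero_iff k (p.2, p.1) hp).symm

theorem mem_symm {G : FinPartialIso U V} {k : ZMod n} {p : V.space k × U.space k} :
    p ∈ G.symm.graph k ↔ (p.2, p.1) ∈ G.graph k := Iff.rfl

/-- The domain of a finite partial isomorphism at a vertex. -/
def dom (G : FinPartialIso U V) (k : ZMod n) : Submodule F (U.space k) :=
  (G.graph k).map (LinearMap.fst F _ _)

theorem mem_dom {G : FinPartialIso U V} {k : ZMod n} {x : U.space k} :
    x ∈ G.dom k ↔ ∃ y, (x, y) ∈ G.graph k := by
  simp [dom, Submodule.mem_map]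

theorem dom_mono {G H : FinPartialIso U V} (h : G ≤ H) (k : ZMod n) : G.dom k ≤ H.dom k :=
  Submodule.map_mono (h k)

instance (G : FinPartialIso U V) (k : ZMod n) : FiniteDimensional F (G.graph k) := G.finite k

instance (G : FinPartialIso U V) (k : ZMod n) : FiniteDimensional F (G.dom k) :=
  inferInstanceAs (FiniteDimensional F ((G.graph k).map (LinearMap.fst F _ _)))

/-- A pair `(x, y)` can be adjoined to a finite partial isomorphism `G` if `G` matches `u_k x` with
`v_k y`, the pair is independent of `G` on both sides, and for each `α` either both `x` and `y` lie
in the `α`-th subspaces or both cosets of `x` and `y` avoid them. -/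
theorem exists_extend (G : FinPartialIso U V) {k : ZMod n} {x : U.space k} {y : V.space k}
    (hmap : (U.map k (k + 1) rfl x, V.map k (k + 1) rfl y) ∈ G.graph (k + 1))
    (hne : ∀ p ∈ G.graph k, x + p.1 ≠ 0 ∧ y + p.2 ≠ 0)
    (hchain : ∀ α : Ordinal.{w}, (x ∈ U.chain α k ∧ y ∈ V.chain α k) ∨
      ∀ p ∈ G.graph k, x + p.1 ∉ U.chain α k ∧ y + p.2 ∉ V.chain α k) :
    ∃ H, G ≤ H ∧ x ∈ H.dom k := by
  classical
  let gr := Function.update G.graph k (G.graph k ⊔ F ∙ (x, y))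
  have hle : ∀ l, G.graph l ≤ gr l := by
    intro l
    by_cases hl : l = k
    · subst hl
      simp [gr]
    · simp [gr, Function.update_of_ne hl]
  -- A new vector lies in `G` or, up to a nonzero scalar, in the coset of `(x, y)`.
  have hcases : ∀ l p, p ∈ gr l → p ∈ G.graph l ∨ ∃ h : l = k, ∃ q ∈ G.graph k, ∃ c : F, c ≠ 0 ∧
      p = c • (h ▸ (x + q.1, y + q.2)) := by
    intro l p hp
    by_cases hl : l = k
    · subst hl
      simp only [gr, Function.update_self] at hp
      obtain ⟨q, hq, z, hz, rfl⟩ := Submodule.mem_sup.1 hp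
      obtain ⟨c, rfl⟩ := Submodule.mem_span_singleton.1 hz
      by_cases hc : c = 0
      · left
        simpa [hc] using hq
      · refine Or.inr ⟨rfl, c⁻¹ • q, Submodule.smul_mem _ _ hq, c, hc, ?_⟩
        ext <;> simp [hc, add_comm]
    · left
      simpa [gr, Function.update_of_ne hl] using hp
  refine ⟨⟨gr, fun l => ?_, fun l m h p hp => ?_, fun l p hp α => ?_, fun l p hp => ?_⟩,
    hle, mem_dom.2 ⟨y, ?_⟩⟩
  · by_cases hl : l = k
    · subst hl
      rw [show gr l = _ from Function.update_self ..]
      infer_instance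
    · rw [show gr l = _ from Function.update_of_ne hl ..]
      infer_instance
  · apply hle m
    rcases hcases l p hp with hp | ⟨rfl, q, hq, c, hc, rfl⟩
    · exact G.map_mem l m h p hp
    · subst h
      have := (G.graph (l + 1)).smul_mem c
        ((G.graph (l + 1)).add_mem hmap (G.map_mem _ _ rfl q hq))
      simpa using this
  · rcases hcases l p hp with hp | ⟨rfl, q, hq, c, hc, rfl⟩
    · exact G.chain_iff l p hp α
    · simp only [Prod.smul_mk, Submodule.smul_mem_iff _ hc]
      rcases hchain α with ⟨hx, hy⟩ | h
      · rw [Submodule.add_mem_iff_right _ hx, Submodule.add_mem_iff_right _ hy]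
        exact G.chain_iff l q hq α
      · exact iff_of_false (h q hq).1 (h q hq).2
  · rcases hcases l p hp with hp | ⟨rfl, q, hq, c, hc, rfl⟩
    · exact G.zero_iff l p hp
    · simp only [Prod.smul_mk, smul_eq_zero, hc, false_or]
      exact iff_of_false (hne q hq).1 (hne q hq).2
  · simp only [gr, Function.update_self]
    exact Submodule.mem_sup_right (Submodule.mem_span_singleton_self _)

/-- A pair `(x, y)` in `U_{k,γ} × V_{k,γ}` can be adjoined to `G` if `G` matches `u_k x` with
`v_k y` and no translate of `x` by the domain or of `y` by the range lies in the `γ+1`-st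
subspace. -/
theorem exists_extend_of_proper (G : FinPartialIso U V) {k : ZMod n} {γ : Ordinal.{w}}
    {x : U.space k} {y : V.space k}
    (hmap : (U.map k (k + 1) rfl x, V.map k (k + 1) rfl y) ∈ G.graph (k + 1))
    (hx : x ∈ U.chain γ k) (hy : y ∈ V.chain γ k)
    (hx' : ∀ p ∈ G.graph k, x + p.1 ∉ U.chain (γ + 1) k)
    (hy' : ∀ p ∈ G.graph k, y + p.2 ∉ V.chain (γ + 1) k) :
    ∃ H, G ≤ H ∧ x ∈ H.dom k := by
  refine G.exists_extend hmap (fun p hp => ⟨fun h => hx' p hp ?_, fun h => hy' p hp ?_⟩)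
    fun α => ?_
  · rw [h]
    exact zero_mem _
  · rw [h]
    exact zero_mem _
  · rcases le_or_gt α γ with h | h
    · exact Or.inl ⟨U.chain_antitone k h hx, V.chain_antitone k h hy⟩
    · have h := Order.add_one_le_of_lt h
      exact Or.inr fun p hp => ⟨fun hp' => hx' p hp (U.chain_antitone k h hp'),
        fun hp' => hy' p hp (V.chain_antitone k h hp')⟩

/-- Adjoining a vector `x` of `U_{k,γ}`, none of whose translates by the domain lies in
`U_{k,γ+1}`, such that `u_k x ∈ U_{k+1,γ+2}`. It has a class in the kernel defining `κ_{k,γ}`,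
outside the finite-dimensional subspace of classes coming from the domain. As the invariants agree, the corresponding subspace on the side of `V` is proper too, which provides the
image of `x`. -/
theorem exists_mem_dom_of_jump (G : FinPartialIso U V) {k : ZMod n} {γ : Ordinal.{w}}
    (hκ : U.kaplansky k γ = V.kaplansky k γ) {x : U.space k}
    (hmap : U.map k (k + 1) rfl x ∈ G.dom (k + 1)) (hx : x ∈ U.jump k γ)
    (hx' : ∀ p ∈ G.graph k, x + p.1 ∉ U.chain (γ + 1) k) :
    ∃ H, G ≤ H ∧ x ∈ H.dom k := by
  let K : Submodule F (U.space k × V.space k) :=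
    G.graph k ⊓ (U.jump k γ).comap (LinearMap.fst F _ _)
  let f : K →ₗ[F] LinearMap.ker (U.layerMap k γ) := U.jumpToKer k γ ∘ₗ
    (LinearMap.fst F _ _).restrict fun p hp => hp.2
  have hKV : ∀ p ∈ K, p.2 ∈ V.jump k γ := fun p hp =>
    ⟨(G.chain_iff k p hp.1 γ).1 hp.2.1,
      (G.chain_iff (k + 1) _ (G.map_mem k (k + 1) rfl p hp.1) _).1 hp.2.2⟩
  let g : K →ₗ[F] LinearMap.ker (V.layerMap k γ) := V.jumpToKer k γ ∘ₗ
    (LinearMap.snd F _ _).restrict hKV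
  have hfg : ∀ p, f p = 0 ↔ g p = 0 := fun p => by
    simp only [f, g, LinearMap.comp_apply, jumpToKer_eq_zero_iff]
    exact G.chain_iff k _ p.2.1 _
  have hf : ¬ Function.Surjective f := by
    intro hf
    obtain ⟨p, hp⟩ := hf (U.jumpToKer k γ ⟨x, hx⟩)
    have h := sub_eq_zero.2 hp.symm
    rw [LinearMap.comp_apply, ← map_sub, jumpToKer_eq_zero_iff] at h
    refine hx' (-p.1) (neg_mem p.2.1) ?_
    simpa [sub_eq_add_neg] using h
  have hg : ¬ Function.Surjective g := fun hg => hf (surjective_of_ker_eq f g hfg hκ hg)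
  simp only [Function.Surjective, not_forall] at hg
  obtain ⟨q, hq⟩ := hg
  obtain ⟨⟨y₀, hy₀⟩, rfl⟩ := V.jumpToKer_surjective k γ q
  obtain ⟨z, hz⟩ := mem_dom.1 hmap
  have hz2 : z ∈ V.chain (γ + 1 + 1) (k + 1) := (G.chain_iff _ _ hz _).1 hx.2
  -- Correct `y₀` by a vector of `V_{k,γ+1}` so that it is mapped to `z`.
  obtain ⟨y₁, hy₁, hy₁z⟩ := V.exists_chain_preimage (γ + 1) k (k + 1) rfl (sub_mem hz2 hy₀.2)
  have hle := V.chain_antitone k (Order.le_succ γ)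
  have hyz : V.map k (k + 1) rfl (y₀ + y₁) = z := by
    rw [map_add, hy₁z, add_sub_cancel]
  refine G.exists_extend_of_proper (y := y₀ + y₁) (by rwa [hyz]) hx.1
    (add_mem hy₀.1 (hle hy₁)) hx' fun p hp h => hq ?_
  have hp2 : p.2 + y₀ ∈ V.chain (γ + 1) k := by
    convert sub_mem h hy₁ using 1
    abel
  have hpγ : p.2 ∈ V.chain γ k := (Submodule.add_mem_iff_left _ hy₀.1).1 (hle hp2)
  have hpK : p.1 ∈ U.jump k γ := by
    refine ⟨(G.chain_iff k p hp γ).2 hpγ,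
      (G.chain_iff (k + 1) _ (G.map_mem k (k + 1) rfl p hp) _).2 ?_⟩
    have h1 := V.map_mem_chain _ k (k + 1) rfl hp2
    have h2 : V.map k (k + 1) rfl y₀ ∈ V.chain (γ + 1 + 1) (k + 1) := hy₀.2
    rw [map_add] at h1
    exact (Submodule.add_mem_iff_left _ h2).1 h1
  let a : K := ⟨p, hp, hpK⟩
  refine ⟨-a, ?_⟩
  rw [map_neg, ← add_eq_zero_iff_neg_eq, LinearMap.comp_apply, ← map_add, jumpToKer_eq_zero_iff]
  exact hp2

/-- Adjoining a vector `x` of `U_{k,γ}` none of whose translates by the domain lies in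
`U_{k,γ+1}`. If no translate of `x` inside `U_{k,γ}` is mapped into `U_{k+1,γ+2}`, then any preimage in `V_{k,γ}` of the vector matched with
`u_k x` can be the image of `x`; otherwise such a translate is adjoined instead. -/
theorem exists_mem_dom_of_proper (G : FinPartialIso U V) {k : ZMod n} {γ : Ordinal.{w}}
    (hκ : U.kaplansky k γ = V.kaplansky k γ) {x : U.space k}
    (hmap : U.map k (k + 1) rfl x ∈ G.dom (k + 1)) (hx : x ∈ U.chain γ k)
    (hx' : ∀ p ∈ G.graph k, x + p.1 ∉ U.chain (γ + 1) k) :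
    ∃ H, G ≤ H ∧ x ∈ H.dom k := by
  by_cases hj : ∃ p ∈ G.graph k, x + p.1 ∈ U.jump k γ
  · obtain ⟨p, hp, hpj⟩ := hj
    have hpd : p.1 ∈ G.dom k := mem_dom.2 ⟨p.2, hp⟩
    obtain ⟨H, hGH, hH⟩ := G.exists_mem_dom_of_jump hκ (x := x + p.1) (by
      rw [map_add]
      exact add_mem hmap (mem_dom.2 ⟨_, G.map_mem k (k + 1) rfl p hp⟩)) hpj fun q hq => by
        rw [add_assoc]
        exact hx' (p + q) (add_mem hp hq)
    exact ⟨H, hGH, (Submodule.add_mem_iff_left _ (dom_mono hGH k hpd)).1 hH⟩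
  · -- A translate of `y` by the range in `V_{k,γ+1}` would be mapped into `V_{k+1,γ+2}`, and the
    -- corresponding translate of `x` would lie in `U.jump k γ`.
    push Not at hj
    obtain ⟨z, hz⟩ := mem_dom.1 hmap
    have hz1 : z ∈ V.chain (γ + 1) (k + 1) :=
      (G.chain_iff _ _ hz _).1 (U.map_mem_chain _ k (k + 1) rfl hx)
    obtain ⟨y, hy, rfl⟩ := V.exists_chain_preimage γ k (k + 1) rfl hz1
    refine G.exists_extend_of_proper hz hx hy hx' fun p hp h => hj p hp ?_
    have hp2 : p.2 ∈ V.chain γ k :=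
      (Submodule.add_mem_iff_right _ hy).1 (V.chain_antitone k (Order.le_succ γ) h)
    refine ⟨add_mem hx ((G.chain_iff k p hp γ).2 hp2), ?_⟩
    have hm := G.map_mem k (k + 1) rfl p hp
    refine (G.chain_iff (k + 1) (U.map k (k + 1) rfl (x + p.1), V.map k (k + 1) rfl (y + p.2)) ?_
      _).2 (V.map_mem_chain _ k (k + 1) rfl h)
    rw [map_add, map_add]
    exact add_mem hz hm

/-- Adjoining a vector of `U_{k,∞}`. A preimage in `V_{k,∞}` of the vector matched with
`u_k x` may already be in the range of `G`, in which case it is corrected by an element of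
`V_{k,∞} ∩ Ker v_k` outside the range of `G`. -/
theorem exists_mem_dom_of_chainInf (G : FinPartialIso U V) {k : ZMod n} {o : Ordinal.{w}}
    (ho : ∀ k, V.chain (o + 1) k = V.chain o k)
    (hκ : U.kaplanskyInf k = V.kaplanskyInf k) {x : U.space k}
    (hmap : U.map k (k + 1) rfl x ∈ G.dom (k + 1)) (hx : x ∈ U.chainInf k) (hxd : x ∉ G.dom k) :
    ∃ H, G ≤ H ∧ x ∈ H.dom k := by
  have hinf : ∀ l, ∀ p ∈ G.graph l, p.1 ∈ U.chainInf l ↔ p.2 ∈ V.chainInf l := fun l p hp => by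
    rw [mem_chainInf, mem_chainInf]
    exact forall_congr' (G.chain_iff l p hp)
  obtain ⟨z, hz⟩ := mem_dom.1 hmap
  -- It suffices to find a preimage of `z` in `V_{k,∞}` outside the range of `G`.
  suffices hy : ∃ y ∈ V.chainInf k, V.map k (k + 1) rfl y = z ∧ y ∉ G.symm.dom k by
    obtain ⟨y, hy, rfl, hyd⟩ := hy
    refine G.exists_extend hz (fun p hp => ⟨fun h => hxd ?_, fun h => hyd ?_⟩) fun α =>
      Or.inl ⟨mem_chainInf.1 hx α, mem_chainInf.1 hy α⟩
    · rw [eq_neg_of_add_eq_zero_left h]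
      exact neg_mem (mem_dom.2 ⟨p.2, hp⟩)
    · rw [eq_neg_of_add_eq_zero_left h]
      exact neg_mem (mem_dom.2 ⟨p.1, hp⟩)
  have hzi : z ∈ V.chainInf (k + 1) := (hinf _ _ hz).1 <| mem_chainInf.2 fun α =>
    U.chain_antitone _ (Order.le_succ α) (U.map_mem_chain α k (k + 1) rfl (mem_chainInf.1 hx α))
  obtain ⟨y₀, hy₀, hy₀z⟩ := exists_chainInf_preimage ho k (k + 1) rfl hzi
  by_cases hyd : y₀ ∈ G.symm.dom k
  swap
  · exact ⟨y₀, hy₀, hy₀z, hyd⟩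
  obtain ⟨s, hs⟩ := mem_dom.1 hyd
  rw [mem_symm] at hs
  let K : Submodule F (U.space k × V.space k) := G.graph k ⊓
    (U.chainInf k ⊓ LinearMap.ker (U.map k (k + 1) rfl)).comap (LinearMap.fst F _ _)
  let f : K →ₗ[F] ↥(U.chainInf k ⊓ LinearMap.ker (U.map k (k + 1) rfl)) :=
    (LinearMap.fst F _ _).restrict fun p hp => hp.2
  have hKV : ∀ p ∈ K, p.2 ∈
      V.chainInf k ⊓ LinearMap.ker (V.map k (k + 1) rfl) := fun p hp =>
    ⟨(hinf k p hp.1).1 hp.2.1,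
      (G.zero_iff (k + 1) _ (G.map_mem k (k + 1) rfl p hp.1)).1 hp.2.2⟩
  let g : K →ₗ[F] ↥(V.chainInf k ⊓ LinearMap.ker (V.map k (k + 1) rfl)) :=
    (LinearMap.snd F _ _).restrict hKV
  have hfg : ∀ p, f p = 0 ↔ g p = 0 := fun p => by
    rw [← Subtype.coe_inj, ← Subtype.coe_inj]
    exact G.zero_iff k _ p.2.1
  have hf : ¬ Function.Surjective f := by
    intro hf
    have hxs : x - s ∈ U.chainInf k ⊓ LinearMap.ker (U.map k (k + 1) rfl) := by
      refine ⟨sub_mem hx ((hinf k _ hs).2 hy₀), ?_⟩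
      have h := sub_mem hz (G.map_mem k (k + 1) rfl _ hs)
      have h0 := (G.zero_iff (k + 1) _ h).2 (by simp [hy₀z])
      simpa using h0
    obtain ⟨p, hp⟩ := hf ⟨x - s, hxs⟩
    have hp : p.1.1 = x - s := congrArg Subtype.val hp
    refine hxd ?_
    rw [← sub_add_cancel x s, ← hp]
    exact add_mem (mem_dom.2 ⟨_, p.2.1⟩) (mem_dom.2 ⟨_, hs⟩)
  have hg : ¬ Function.Surjective g := fun hg => hf (surjective_of_ker_eq f g hfg hκ hg)
  simp only [Function.Surjective, not_forall] at hg
  obtain ⟨⟨y₁, hy₁⟩, hq⟩ := hg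
  refine ⟨y₀ + y₁, add_mem hy₀ hy₁.1, ?_, fun h => hq ?_⟩
  · rw [map_add, hy₀z, LinearMap.mem_ker.1 hy₁.2, add_zero]
  · obtain ⟨a, ha⟩ := mem_dom.1 ((Submodule.add_mem_iff_right _ hyd).1 h)
    rw [mem_symm] at ha
    refine ⟨⟨(a, y₁), ha, (hinf k _ ha).2 hy₁.1,
      (G.zero_iff (k + 1) _ (G.map_mem k (k + 1) rfl _ ha)).2 hy₁.2⟩, rfl⟩

end FinPartialIso

/-- Given a finite-dimensional `W` not contained in `S`, either `W` contains a vector of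
`U_{k,∞}` outside `S`, or `W ∩ U_{k,γ}` escapes from `S` for a last ordinal `γ`. -/
theorem exists_last_escape {U : CyclicRep.{u, w} F n} {o : Ordinal.{w}}
    (ho : ∀ k, U.chain (o + 1) k = U.chain o k) {k : ZMod n} (S W : Submodule F (U.space k))
    [FiniteDimensional F W] (hWS : ¬ W ≤ S) :
    (∃ x ∈ W, x ∈ U.chainInf k ∧ x ∉ S) ∨ ∃ γ : Ordinal.{w}, ∃ x ∈ W, x ∈ U.chain γ k ∧ x ∉ S ∧
      W ⊓ U.chain (γ + 1) k ≤ S := by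
  by_cases hβ : ∃ β : Ordinal.{w}, W ⊓ U.chain β k ≤ S
  swap
  · push Not at hβ
    obtain ⟨x, hx, hxS⟩ := SetLike.not_le_iff_exists.1 (hβ o)
    exact Or.inl ⟨x, hx.1, (chainInf_eq ho k).symm ▸ hx.2, hxS⟩
  right
  obtain ⟨β, hβ, hmin⟩ := WellFounded.has_min (wellFounded_lt (α := Ordinal.{w}))
    {β | W ⊓ U.chain β k ≤ S} hβ
  replace hmin : ∀ δ < β, ∃ x ∈ W ⊓ U.chain δ k, x ∉ S := fun δ hδ =>
    SetLike.not_le_iff_exists.1 fun h => hmin δ h hδ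
  rcases Ordinal.zero_or_succ_or_isSuccLimit β with rfl | ⟨γ, rfl⟩ | hl
  · refine absurd ?_ hWS
    rw [Set.mem_ofPred_eq, chain_zero, inf_top_eq] at hβ
    exact hβ
  · obtain ⟨x, hx, hxS⟩ := hmin γ (Order.lt_succ γ)
    exact ⟨γ, x, hx.1, hx.2, hxS, hβ⟩
  · -- At a limit the subspaces `W ∩ U_{k,δ}` have already stabilised, so `β` is not minimal.
    exfalso
    let c : Set.Iio β → Submodule F W := fun δ => (U.chain δ k).comap W.subtype
    have : Nonempty (Set.Iio β) := ⟨⟨0, hl.bot_lt⟩⟩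
    obtain ⟨_, ⟨⟨δ, hδ⟩, rfl⟩, hδmin⟩ :=
      WellFounded.has_min (wellFounded_lt (α := Submodule F W)) (Set.range c)
        (Set.range_nonempty c)
    obtain ⟨x, hx, hxS⟩ := hmin δ hδ
    refine hxS (hβ ⟨hx.1, ?_⟩)
    rw [SetLike.mem_coe, chain_limit _ _ hl]
    simp only [Submodule.mem_iInf]
    intro ε hε
    rcases le_total ε δ with h | h
    · exact U.chain_antitone k h hx.2
    · have hle : c ⟨ε, hε⟩ ≤ c ⟨δ, hδ⟩ := Submodule.comap_mono (U.chain_antitone k h)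
      have heq : c ⟨ε, hε⟩ = c ⟨δ, hδ⟩ :=
        hle.eq_of_not_lt (hδmin _ ⟨_, rfl⟩)
      have hx' : (⟨x, hx.1⟩ : W) ∈ c ⟨δ, hδ⟩ := hx.2
      rw [← heq] at hx'
      exact hx'

namespace FinPartialIso

variable {U V : CyclicRep.{u, w} F n} [NeZero n]

/-- The extension step of the back-and-forth argument. -/
theorem exists_mem_dom_of_map_mem (hU : U.dim ≤ Cardinal.aleph0) (hV : V.dim ≤ Cardinal.aleph0)
    (hκ : ∀ (k : ZMod n) (α : Ordinal.{w}), α < Ordinal.omega 1 →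
      U.kaplansky k α = V.kaplansky k α)
    (hκ' : ∀ k : ZMod n, U.kaplanskyInf k = V.kaplanskyInf k) (G : FinPartialIso U V) {k : ZMod n}
    {x : U.space k} (hmap : U.map k (k + 1) rfl x ∈ G.dom (k + 1)) :
    ∃ H, G ≤ H ∧ x ∈ H.dom k := by
  by_cases hxd : x ∈ G.dom k
  · exact ⟨G, le_rfl, hxd⟩
  obtain ⟨o, ho1, ho⟩ := exists_chain_add_one_eq hU
  obtain ⟨o', -, ho'⟩ := exists_chain_add_one_eq hV
  -- Any vector of `W = dom G + F x` outside `dom G` may be adjoined instead of `x`.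
  set W := G.dom k ⊔ F ∙ x with hW
  have hxW : x ∈ W := Submodule.mem_sup_right (Submodule.mem_span_singleton_self x)
  have hsub : ∀ x' ∈ W, x' ∉ G.dom k → U.map k (k + 1) rfl x' ∈ G.dom (k + 1) ∧
      ((∃ H, G ≤ H ∧ x' ∈ H.dom k) → ∃ H, G ≤ H ∧ x ∈ H.dom k) := by
    intro x' hx' hx'd
    obtain ⟨s, hs, z, hz, rfl⟩ := Submodule.mem_sup.1 hx'
    obtain ⟨c, rfl⟩ := Submodule.mem_span_singleton.1 hz
    obtain ⟨t, ht⟩ := mem_dom.1 hs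
    have hc : c ≠ 0 := by
      rintro rfl
      exact hx'd (by simpa using hs)
    refine ⟨?_, fun ⟨H, hGH, hH⟩ => ⟨H, hGH, ?_⟩⟩
    · rw [map_add, map_smul]
      exact add_mem (mem_dom.2 ⟨_, G.map_mem k (k + 1) rfl _ ht⟩) (Submodule.smul_mem _ _ hmap)
    · rwa [Submodule.add_mem_iff_right _ (dom_mono hGH k hs), Submodule.smul_mem_iff _ hc] at hH
  rcases exists_last_escape ho (G.dom k) W fun h => hxd (h hxW) with
    ⟨x', hx'W, hx', hx'd⟩ | ⟨γ, x', hx'W, hx', hx'd, hlast⟩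
  · obtain ⟨hm, himp⟩ := hsub x' hx'W hx'd
    exact himp (G.exists_mem_dom_of_chainInf ho' (hκ' k) hm hx' hx'd)
  · obtain ⟨hm, himp⟩ := hsub x' hx'W hx'd
    have hprop : ∀ p ∈ G.graph k, x' + p.1 ∉ U.chain (γ + 1) k := fun p hp h => by
      have hpd : p.1 ∈ G.dom k := mem_dom.2 ⟨p.2, hp⟩
      have := hlast ⟨add_mem hx'W (Submodule.mem_sup_left hpd), h⟩
      exact hx'd ((Submodule.add_mem_iff_left _ hpd).1 this)
    have hγ : γ < o := lt_of_mem_chain_of_notMem ho hx' (by simpa using hprop 0 (zero_mem _))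
    exact himp (G.exists_mem_dom_of_proper (hκ k γ (hγ.trans ho1)) hm hx' hprop)

theorem exists_mem_dom (hUn : U.IsLocallyNilpotent) (hU : U.dim ≤ Cardinal.aleph0)
    (hV : V.dim ≤ Cardinal.aleph0)
    (hκ : ∀ (k : ZMod n) (α : Ordinal.{w}), α < Ordinal.omega 1 →
      U.kaplansky k α = V.kaplansky k α)
    (hκ' : ∀ k : ZMod n, U.kaplanskyInf k = V.kaplanskyInf k) (k : ZMod n) (x : U.space k)
    (G : FinPartialIso U V) : ∃ H, G ≤ H ∧ x ∈ H.dom k := by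
  revert G
  refine hUn.induction (P := fun k x => ∀ G : FinPartialIso U V, ∃ H, G ≤ H ∧ x ∈ H.dom k)
    (fun k G => ⟨G, le_rfl, zero_mem _⟩) (fun k l h x ih G => ?_) k x
  subst h
  obtain ⟨H, hGH, hH⟩ := ih G
  obtain ⟨H', hHH', hH'⟩ := exists_mem_dom_of_map_mem hU hV hκ hκ' H hH
  exact ⟨H', hGH.trans hHH', hH'⟩

theorem exists_mem_symm_dom (hVn : V.IsLocallyNilpotent) (hU : U.dim ≤ Cardinal.aleph0)
    (hV : V.dim ≤ Cardinal.aleph0)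
    (hκ : ∀ (k : ZMod n) (α : Ordinal.{w}), α < Ordinal.omega 1 →
      U.kaplansky k α = V.kaplansky k α)
    (hκ' : ∀ k : ZMod n, U.kaplanskyInf k = V.kaplanskyInf k) (k : ZMod n) (y : V.space k)
    (G : FinPartialIso U V) : ∃ H, G ≤ H ∧ y ∈ H.symm.dom k := by
  obtain ⟨H, hGH, hH⟩ := exists_mem_dom hVn hV hU (fun k α hα => (hκ k α hα).symm)
    (fun k => (hκ' k).symm) k y G.symm
  exact ⟨H.symm, fun l p hp => hGH l hp, hH⟩

end FinPartialIso

/-! ### Back and forth -/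

/-- An ideal of finite partial isomorphisms whose domains and ranges cover bases of all the spaces
glues to an isomorphism. -/
theorem isIsomorphic_of_ideal {U V : CyclicRep.{u, w} F n} (I : Order.Ideal (FinPartialIso U V))
    {ι κ : ZMod n → Type*} (b : ∀ k, Module.Basis (ι k) F (U.space k))
    (c : ∀ k, Module.Basis (κ k) F (V.space k))
    (hb : ∀ k i, ∃ G ∈ I, b k i ∈ G.dom k) (hc : ∀ k i, ∃ G ∈ I, c k i ∈ G.symm.dom k) :
    U.IsIsomorphic V := by
  let Γ : ∀ k, Submodule F (U.space k × V.space k) := fun k => ⨆ G : I, G.1.graph k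
  have : Nonempty I := I.nonempty.to_subtype
  have hΓ : ∀ k p, p ∈ Γ k ↔ ∃ G : I, p ∈ G.1.graph k := fun k p => by
    refine Submodule.mem_iSup_of_directed _ fun G H => ?_
    obtain ⟨K, hK, hGK, hHK⟩ := I.directed G.1 G.2 H.1 H.2
    exact ⟨⟨K, hK⟩, hGK k, hHK k⟩
  let p₁ : ∀ k, Γ k →ₗ[F] U.space k := fun k => LinearMap.fst F _ _ ∘ₗ (Γ k).subtype
  let p₂ : ∀ k, Γ k →ₗ[F] V.space k := fun k => LinearMap.snd F _ _ ∘ₗ (Γ k).subtype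
  have hzero : ∀ k (p : Γ k), p.1.1 = 0 ↔ p.1.2 = 0 := fun k p => by
    obtain ⟨G, hG⟩ := (hΓ k p).1 p.2
    exact G.1.zero_iff k p hG
  have h₁ : ∀ k, Function.Bijective (p₁ k) := fun k => by
    refine ⟨(injective_iff_map_eq_zero _).2 fun p hp =>
      Subtype.ext (Prod.ext hp ((hzero k p).1 hp)), ?_⟩
    rw [← LinearMap.range_eq_top, eq_top_iff, ← (b k).span_eq, Submodule.span_le]
    rintro _ ⟨i, rfl⟩
    obtain ⟨G, hGI, hG⟩ := hb k i
    obtain ⟨y, hy⟩ := FinPartialIso.mem_dom.1 hG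
    exact ⟨⟨(b k i, y), (hΓ k _).2 ⟨⟨G, hGI⟩, hy⟩⟩, rfl⟩
  have h₂ : ∀ k, Function.Bijective (p₂ k) := fun k => by
    refine ⟨(injective_iff_map_eq_zero _).2 fun p hp =>
      Subtype.ext (Prod.ext ((hzero k p).2 hp) hp), ?_⟩
    rw [← LinearMap.range_eq_top, eq_top_iff, ← (c k).span_eq, Submodule.span_le]
    rintro _ ⟨i, rfl⟩
    obtain ⟨G, hGI, hG⟩ := hc k i
    obtain ⟨x, hx⟩ := FinPartialIso.mem_dom.1 hG
    exact ⟨⟨(x, c k i), (hΓ k _).2 ⟨⟨G, hGI⟩, hx⟩⟩, rfl⟩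
  let e₁ : ∀ k, Γ k ≃ₗ[F] U.space k := fun k => LinearEquiv.ofBijective (p₁ k) (h₁ k)
  let e₂ : ∀ k, Γ k ≃ₗ[F] V.space k := fun k => LinearEquiv.ofBijective (p₂ k) (h₂ k)
  refine ⟨fun k => (e₁ k).symm.trans (e₂ k), fun k l h => LinearMap.ext fun x => ?_⟩
  obtain ⟨p, rfl⟩ := (e₁ k).surjective x
  have hq : (U.map k l h p.1.1, V.map k l h p.1.2) ∈ Γ l := by
    obtain ⟨G, hG⟩ := (hΓ k p).1 p.2
    exact (hΓ l _).2 ⟨G, G.1.map_mem k l h p hG⟩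
  have hp : U.map k l h (e₁ k p) = e₁ l ⟨_, hq⟩ := rfl
  simp only [LinearMap.comp_apply, LinearEquiv.coe_coe, LinearEquiv.trans_apply,
    LinearEquiv.symm_apply_apply, hp]
  rfl

theorem isIsomorphic_of_kaplansky_eq [NeZero n] {U V : CyclicRep.{u, w} F n}
    (hUn : U.IsLocallyNilpotent) (hVn : V.IsLocallyNilpotent)
    (hU : U.dim ≤ Cardinal.aleph0) (hV : V.dim ≤ Cardinal.aleph0)
    (hκ : ∀ (k : ZMod n) (α : Ordinal.{w}), α < Ordinal.omega 1 →
      U.kaplansky k α = V.kaplansky k α)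
    (hκ' : ∀ k : ZMod n, U.kaplanskyInf k = V.kaplanskyInf k) : U.IsIsomorphic V := by
  let b := fun k => Module.Basis.ofVectorSpace F (U.space k)
  let c := fun k => Module.Basis.ofVectorSpace F (V.space k)
  have hb : ∀ k, Countable (Module.Basis.ofVectorSpaceIndex F (U.space k)) := fun k => by
    rw [← Cardinal.mk_le_aleph0_iff, (b k).mk_eq_rank'']
    exact rank_le_aleph0 hU k
  have hc : ∀ k, Countable (Module.Basis.ofVectorSpaceIndex F (V.space k)) := fun k => by
    rw [← Cardinal.mk_le_aleph0_iff, (c k).mk_eq_rank'']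
    exact rank_le_aleph0 hV k
  let ι := (Σ k : ZMod n, Module.Basis.ofVectorSpaceIndex F (U.space k)) ⊕
    (Σ k : ZMod n, Module.Basis.ofVectorSpaceIndex F (V.space k))
  have : Encodable ι := Encodable.ofCountable ι
  let D : ι → Order.Cofinal (FinPartialIso U V) := Sum.elim
    (fun i => ⟨{G | b i.1 i.2 ∈ G.dom i.1}, fun G =>
      let ⟨H, hGH, hH⟩ := FinPartialIso.exists_mem_dom hUn hU hV hκ hκ' i.1 (b i.1 i.2) G
      ⟨H, hH, hGH⟩⟩)
    (fun i => ⟨{G | c i.1 i.2 ∈ G.symm.dom i.1}, fun G =>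
      let ⟨H, hGH, hH⟩ := FinPartialIso.exists_mem_symm_dom hVn hU hV hκ hκ' i.1 (c i.1 i.2) G
      ⟨H, hH, hGH⟩⟩)
  refine isIsomorphic_of_ideal (Order.idealOfCofinals default D) b c (fun k i => ?_) fun k i => ?_
  · obtain ⟨G, hG, hGI⟩ := Order.cofinal_meets_idealOfCofinals default D (Sum.inl ⟨k, i⟩)
    exact ⟨G, hGI, hG⟩
  · obtain ⟨G, hG, hGI⟩ := Order.cofinal_meets_idealOfCofinals default D (Sum.inr ⟨k, i⟩)
    exact ⟨G, hGI, hG⟩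

end CyclicRep

theorem mainTheorem1 {F : Type u} [Field F] {n : ℕ} [NeZero n] (U V : CyclicRep.{u, w} F n)
    (hU : U.IsLocallyNilpotent) (hV : V.IsLocallyNilpotent)
    (hUdim : U.dim ≤ Cardinal.aleph0) (hVdim : V.dim ≤ Cardinal.aleph0) :
    U.IsIsomorphic V ↔
      (∀ (k : ZMod n) (α : Ordinal.{w}), α < Ordinal.omega 1 → U.kaplansky k α = V.kaplansky k α) ∧
        ∀ k : ZMod n, U.kaplanskyInf k = V.kaplanskyInf k := by
  constructor
  · rintro ⟨φ, hφ⟩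
    have h : ∀ (k l : ZMod n) (h : k + 1 = l) (x : U.space k),
        V.map k l h (φ k x) = φ l (U.map k l h x) := fun k l h x => LinearMap.congr_fun (hφ k l h) x
    exact ⟨fun k α _ => CyclicRep.kaplansky_eq_of_iso φ h k α,
      CyclicRep.kaplanskyInf_eq_of_iso φ h⟩
  · rintro ⟨hκ, hκ'⟩
    exact CyclicRep.isIsomorphic_of_kaplansky_eq hU hV hUdim hVdim hκ hκ'
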